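/- Let $N\ge 2$ and let $H_0,H_1$ be Hermitian $N\times N$ matrices. For $\theta\in\mathbb{S}^1=\mathbb{R}/2\pi\mathbb{Z}$ put $H_\theta=H_0\cos\theta+H_1\sin\theta$, with eigenvalues $\lambda_1(\theta)\le\lambda_2(\theta)\le\dots\le\lambda_N(\theta)$ repeated according to multiplicity, and let $\phi(z)=\langle z|H_0+\imath H_1|z\rangle$ and $\phi_\theta(z)=\langle z|H_\theta|z\rangle$ on $\mathbb{CP}^{N-1}$ (unit vectors modulo phase). A first excited critical value curve is a $C^\infty$ map $\gamma:\mathbb{S}^1\to\mathbb{C}$ such that for every $\theta$ there is a critical point $z$ of $\phi_\theta$ with critical value $\phi_\theta(z)=\lambda_2(\theta)$ and $\gamma(\theta)=\phi(z)$. Its lift to the contact space $\mathbb{C}\times\mathbb{S}^1$, with contact form $\alpha=\cos\theta\,dx+\sin\theta\,dy$, is $\bar\gamma(\theta)=(\gamma(\theta),\theta)$. (1) If the multiplicity of the eigenvalue $\lambda_2(\theta)$ of $H_\theta$ does not depend on $\theta$ (in particular, if $\lambda_2(\theta)$ is simple for every $\theta$), then there is exactly one first excited critical value curve. (2) For every first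 excited critical value curve $\gamma$, the lift $\bar\gamma$ is a Legendrian knot, that is, a $C^\infty$ embedding of $\mathbb{S}^1$ in $\mathbb{C}\times\mathbb{S}^1$ with $\alpha(\bar\gamma')=0$, and it is unknotted: it is smoothly ambient isotopic in $\mathbb{C}\times\mathbb{S}^1$ to the lift $\theta\mapsto(e^{\imath\theta},\theta)$ of the round circle. Moreover, its image in $\mathbb{R}^3=\mathbb{C}\times\mathbb{R}$ under the identification $(x+\imath y,\theta)\mapsto(e^{x}e^{\imath\theta},y)$ of $\mathbb{C}\times\mathbb{S}^1$ with the complement of the axis $\{0\}\times\mathbb{R}$ is an unknot, that is, smoothly ambient isotopic in $\mathbb{R}^3$ to the round circle $\{(e^{\imath\theta},0)\}$. -/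

import Mathlib

open scoped Manifold ContDiff ComplexInnerProductSpace

noncomputable section

/-! ### Hamiltonians, energy levels and critical value curves -/

/-- The Hamiltonian `H_θ = H₀ cos θ + H₁ sin θ` at the point `u = e^{iθ}` of the circular path. -/
def pencil {N : ℕ} (H₀ H₁ : Matrix (Fin N) (Fin N) ℂ) (u : Circle) :
    Matrix (Fin N) (Fin N) ℂ :=
  (((u : ℂ).re : ℝ) : ℂ) • H₀ + (((u : ℂ).im : ℝ) : ℂ) • H₁

theorem pencil_isHermitian {N : ℕ} {H₀ H₁ : Matrix (Fin N) (Fin N) ℂ}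
    (h₀ : H₀.IsHermitian) (h₁ : H₁.IsHermitian) (u : Circle) :
    (pencil H₀ H₁ u).IsHermitian := by
  unfold pencil
  apply Matrix.IsHermitian.add <;>
    simp [Matrix.IsHermitian, Matrix.conjTranspose_smul, h₀.eq, h₁.eq]

/-- The eigenvalues of `H_θ`, repeated according to multiplicity and listed in increasing order:
index `0` is the ground level, index `1` the first excited level. -/
def energyLevel {N : ℕ} {H₀ H₁ : Matrix (Fin N) (Fin N) ℂ}
    (h₀ : H₀.IsHermitian) (h₁ : H₁.IsHermitian) (k : Fin N) (u : Circle) : ℝ :=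
  (pencil_isHermitian h₀ h₁ u).eigenvalues₀ (Fin.cast (Fintype.card_fin N).symm k.rev)

/-- The multiplicity of the eigenvalue `λ_k(θ)` of `H_θ`. -/
def levelMultiplicity {N : ℕ} {H₀ H₁ : Matrix (Fin N) (Fin N) ℂ}
    (h₀ : H₀.IsHermitian) (h₁ : H₁.IsHermitian) (k : Fin N) (u : Circle) : ℕ :=
  (Finset.univ.filter fun j : Fin N => energyLevel h₀ h₁ j u = energyLevel h₀ h₁ k u).card

/-- The numerical range mapping `φ(z) = ⟨z|H₀ + i H₁|z⟩`. -/
def numRangeMap {N : ℕ} (H₀ H₁ : Matrix (Fin N) (Fin N) ℂ) (z : EuclideanSpace ℂ (Fin N)) : ℂ :=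
  ⟪z, Matrix.toEuclideanLin (H₀ + Complex.I • H₁) z⟫

/-- The energy function `φ_θ(z) = ⟨z|H₀ cos θ + H₁ sin θ|z⟩` (real, as `H₀, H₁` are Hermitian). -/
def energy {N : ℕ} (H₀ H₁ : Matrix (Fin N) (Fin N) ℂ) (u : Circle)
    (z : EuclideanSpace ℂ (Fin N)) : ℝ :=
  (⟪z, Matrix.toEuclideanLin (pencil H₀ H₁ u) z⟫).re

/-- The unit vector `z` represents a critical point of `φ_θ` on complex projective space: the
differential of `φ_θ` vanishes on the complex orthogonal complement of `z`, which is the tangent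
space of projective space at the class of `z`. -/
def IsCriticalPoint {N : ℕ} (H₀ H₁ : Matrix (Fin N) (Fin N) ℂ) (u : Circle)
    (z : EuclideanSpace ℂ (Fin N)) : Prop :=
  ‖z‖ = 1 ∧ ∀ w : EuclideanSpace ℂ (Fin N), ⟪z, w⟫ = 0 → fderiv ℝ (energy H₀ H₁ u) z w = 0

/-- `γ` is a (smooth, closed, `θ`-parametrized) critical value curve of the `k`-th energy level:
`γ(θ)` is the value of the numerical range mapping at a critical point of `φ_θ` with critical
value `λ_k(θ)`. -/
structure IsCriticalValueCurve {N : ℕ} {H₀ H₁ : Matrix (Fin N) (Fin N) ℂ}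
    (h₀ : H₀.IsHermitian) (h₁ : H₁.IsHermitian) (k : Fin N) (γ : Circle → ℂ) : Prop where
  smooth : ContMDiff (𝓡 1) 𝓘(ℝ, ℂ) ∞ γ
  criticalValue : ∀ u : Circle, ∃ z : EuclideanSpace ℂ (Fin N),
    IsCriticalPoint H₀ H₁ u z ∧ energy H₀ H₁ u z = energyLevel h₀ h₁ k u ∧
      γ u = numRangeMap H₀ H₁ z

/-! ### The contact space and Legendrian knots -/

/-- The contact space `ℂ × S¹`. -/
abbrev ContactSpace : Type := ℂ × Circle

/-- The smooth structure of the contact space. -/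
abbrev contactModel :
    ModelWithCorners ℝ (ℂ × EuclideanSpace ℝ (Fin 1))
      (ModelProd ℂ (EuclideanSpace ℝ (Fin 1))) :=
  𝓘(ℝ, ℂ).prod (𝓡 1)

/-- The contact form `α = cos θ dx + sin θ dy` on the contact space. -/
def contactForm (p : ContactSpace) (v : TangentSpace contactModel p) : ℝ :=
  let dz : ℂ := Prod.fst (α := ℂ) (β := EuclideanSpace ℝ (Fin 1)) v
  (p.2 : ℂ).re * dz.re + (p.2 : ℂ).im * dz.im

/-- A Legendrian knot: an injective immersion of the (compact) circle, hence an embedding, that is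
everywhere tangent to the kernel of the contact form. -/
structure IsLegendrianKnot (K : Circle → ContactSpace) : Prop where
  smooth : ContMDiff (𝓡 1) contactModel ∞ K
  injective : Function.Injective K
  immersion : ∀ u : Circle, Function.Injective (mfderiv (𝓡 1) contactModel K u)
  legendrian : ∀ (u : Circle) (v : TangentSpace (𝓡 1) u),
    contactForm (K u) (mfderiv (𝓡 1) contactModel K u v) = 0

/-- The lift of a `θ`-parametrized plane curve to the contact space, `θ ↦ (x(θ), y(θ), θ)`. -/
def contactLift (γ : Circle → ℂ) (u : Circle) : ContactSpace := (γ u, u)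

/-! ### Unknots -/

/-- Two subsets of a manifold are smoothly ambient isotopic. -/
def AmbientIsotopic {E H M : Type*} [NormedAddCommGroup E] [NormedSpace ℝ E] [TopologicalSpace H]
    (I : ModelWithCorners ℝ E H) [TopologicalSpace M] [ChartedSpace H M] (A B : Set M) : Prop :=
  ∃ Φ : ℝ → M ≃ₘ^∞⟮I, I⟯ M,
    ContMDiff (𝓘(ℝ, ℝ).prod I) I ∞ (fun p : ℝ × M => Φ p.1 p.2) ∧
    (∀ x, Φ 0 x = x) ∧ Φ 1 '' A = B

/-- A knot in the contact space is unknotted there if it is ambient isotopic to the lift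
`θ ↦ (cos θ, sin θ, θ)` of the simple closed curve `θ ↦ (cos θ, sin θ)`. -/
def IsContactUnknot (K : Circle → ContactSpace) : Prop :=
  AmbientIsotopic contactModel (Set.range K)
    (Set.range (contactLift fun u : Circle => (u : ℂ)))

/-- The standard identification of the contact space with the open solid torus
`ℝ³ ∖ (axis)`, where `ℝ³ = ℂ × ℝ`: the fibre `{x + iy} × S¹` goes to the round circle
of radius `eˣ` at height `y`. -/
def toThreeSpace (p : ContactSpace) : ℂ × ℝ :=
  ((Real.exp p.1.re : ℂ) * (p.2 : ℂ), p.1.im)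

/-- A knot in `ℝ³ = ℂ × ℝ` is an unknot if it is ambient isotopic to the round circle. -/
def IsUnknot (K : Circle → ℂ × ℝ) : Prop :=
  AmbientIsotopic 𝓘(ℝ, ℂ × ℝ) (Set.range K)
    (Set.range fun u : Circle => ((u : ℂ), (0 : ℝ)))

end

/-!
Critical points of `φ_θ` on the level `λ_k` are the unit eigenvectors `z` of `H_θ` for `λ_k(θ)`,
and the value `φ(z)` has, in the frame rotated by `θ`, the coordinates `⟨z|H_θ|z⟩ = λ_k(θ)` and
`⟨z|dH_θ/dθ|z⟩`. If the multiplicity of `λ_k` is constant near `θ`, then `λ_k` is smooth there and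
the second coordinate is `λ_k'(θ)` for every choice of `z` (`hasDerivAt_eigenvalue`). This rests
on the implicit function theorem for a scalar equation built from the inverse of `H_θ - x + P`,
with `P` the projection onto an eigenspace, together with the continuity of `λ_k`
(`abs_eigenvalues_sub_le`). So, with constant multiplicity, `γ = e^{iθ} (λ_k + i λ_k')` is the one
critical value curve (`existsUnique_isCriticalValueCurve`).

For a general critical value curve the multiplicity is still locally constant on a dense set of
angles, because the dimension of the kernel of `H_θ - λ_k(θ)` is upper semicontinuous. There the
lift of `γ` is the one-jet of `λ_k`, which is the contact condition, and smoothness of `γ` extends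
it to all angles (`IsCriticalValueCurve.legendrian`).

The unknottedness only uses that the lift is a section of `ℂ × S¹ → S¹`. In the contact space a
fibrewise translation moves it to any other section (`isContactUnknot_contactLift`). In
three-space the curve meets each half-plane bounded by the axis once, and it is straightened by a
vertical shear, a rescaling of horizontal planes and another vertical shear
(`isUnknot_of_star_shaped`).
-/

open Filter Topology

/-! ### An eigenvalue of constant multiplicity is smooth -/

section Perturbation

variable {V : Type*} [NormedAddCommGroup V] [InnerProductSpace ℂ V]

theorem isSymmetric_sub_smul_one {A : V →L[ℂ] V} (hA : A.toLinearMap.IsSymmetric) (c : ℝ) :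
    (A - c • 1 : V →L[ℂ] V).toLinearMap.IsSymmetric := by
  intro x y
  have := hA x y
  simp only [ContinuousLinearMap.coe_coe] at this
  simp [inner_sub_left, inner_sub_right, inner_smul_left_eq_smul, inner_smul_right_eq_smul, this]

variable [FiniteDimensional ℂ V]

theorem isUnit_of_forall_apply_eq_zero {B : V →L[ℂ] V} (hB : ∀ x, B x = 0 → x = 0) :
    IsUnit B := by
  have hinj : Function.Injective B := (injective_iff_map_eq_zero B).2 hB
  rw [ContinuousLinearMap.isUnit_iff_bijective]
  exact ⟨hinj, (LinearMap.injective_iff_surjective (f := (B : V →ₗ[ℂ] V))).1 hinj⟩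

/-- The range of a symmetric operator is orthogonal to its kernel, so adding the orthogonal
projection onto the kernel produces an injective operator. -/
theorem apply_eq_zero_of_apply_add_starProjection_ker {A : V →L[ℂ] V}
    (hA : (A : V →ₗ[ℂ] V).IsSymmetric) {x : V}
    (hx : (A + (LinearMap.ker (A : V →ₗ[ℂ] V)).starProjection) x = 0) : x = 0 := by
  set K := LinearMap.ker (A : V →ₗ[ℂ] V)
  have hQ : K.starProjection x ∈ K := K.starProjection_apply_mem x
  have hs : A x = -K.starProjection x := eq_neg_of_add_eq_zero_left hx
  have hQ0 : A (K.starProjection x) = 0 := hQ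
  have hzero : A x = 0 := by
    rw [← inner_self_eq_zero (𝕜 := ℂ)]
    nth_rw 2 [hs]
    have := hA x (K.starProjection x)
    simp only [ContinuousLinearMap.coe_coe] at this
    rw [inner_neg_right, this, hQ0, inner_zero_right, neg_zero]
  have h2 : K.starProjection x = 0 := by
    rw [hzero] at hs; simpa using hs.symm
  rwa [Submodule.starProjection_eq_self_iff.2 (show x ∈ K from hzero)] at h2

theorem isUnit_add_starProjection_ker {A : V →L[ℂ] V}
    (hA : (A : V →ₗ[ℂ] V).IsSymmetric) :
    IsUnit (A + (LinearMap.ker (A : V →ₗ[ℂ] V)).starProjection) :=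
  isUnit_of_forall_apply_eq_zero fun _ hx => apply_eq_zero_of_apply_add_starProjection_ker hA hx

/-- The orthogonal projection onto `K`, restricted to the kernel of `A`. -/
noncomputable def kerProjection (A : V →L[ℂ] V) (K : Submodule ℂ V) :
    LinearMap.ker (A : V →ₗ[ℂ] V) →ₗ[ℂ] K :=
  (K.orthogonalProjectionOnto : V →ₗ[ℂ] K) ∘ₗ (LinearMap.ker (A : V →ₗ[ℂ] V)).subtype

theorem kerProjection_injective {A : V →L[ℂ] V} {K : Submodule ℂ V}
    (hU : IsUnit (A + K.starProjection)) : Function.Injective (kerProjection A K) := by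
  rw [injective_iff_map_eq_zero]
  rintro ⟨w, hw⟩ h
  have hw' : A w = 0 := hw
  have h' : K.starProjection w = 0 := congrArg Subtype.val h
  have h2 : (A + K.starProjection) w = 0 := by simp [hw', h']
  have hinj := (ContinuousLinearMap.isUnit_iff_bijective.1 hU).1
  exact Subtype.ext ((injective_iff_map_eq_zero _).1 hinj w h2)

/-- Since `A + P_K` is invertible for every `A` close to a symmetric operator with kernel `K`,
this is the upper semicontinuity of the dimension of the kernel. -/
theorem finrank_ker_le {A : V →L[ℂ] V} {K : Submodule ℂ V}
    (hU : IsUnit (A + K.starProjection)) :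
    Module.finrank ℂ (LinearMap.ker (A : V →ₗ[ℂ] V)) ≤ Module.finrank ℂ K :=
  LinearMap.finrank_le_finrank_of_injective (kerProjection_injective hU)

/-- A scalar equation satisfied by `A` when its kernel has the dimension of `K`: the vector
`(A + P_K)⁻¹ z` is then the element of the kernel of `A` that projects to `z`. -/
theorem inner_inverse_apply_self {A : V →L[ℂ] V} {K : Submodule ℂ V}
    (hU : IsUnit (A + K.starProjection))
    (hdim : Module.finrank ℂ (LinearMap.ker (A : V →ₗ[ℂ] V)) = Module.finrank ℂ K)
    {z : V} (hz : z ∈ K) : ⟪z, Ring.inverse (A + K.starProjection) z⟫ = ⟪z, z⟫ := by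
  obtain ⟨⟨w, hw⟩, hwz⟩ := (LinearMap.injective_iff_surjective_of_finrank_eq_finrank hdim).1
    (kerProjection_injective hU) ⟨z, hz⟩
  have hw' : A w = 0 := hw
  have hwz' : K.starProjection w = z := congrArg Subtype.val hwz
  have h1 : Ring.inverse (A + K.starProjection) z = w := by
    have : (A + K.starProjection) w = z := by simp [hw', hwz']
    rw [← this, ← mul_apply_eq_comp, Ring.inverse_mul_cancel _ hU]
    rfl
  rw [h1]
  conv_rhs => rw [← hwz']
  rw [← hwz', ← Submodule.inner_starProjection_left_eq_right,
    Submodule.starProjection_eq_self_iff.2 (K.starProjection_apply_mem w)]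

/-- If `λ(t)` is an eigenvalue of `T(t)` of constant multiplicity near `t₀`, then `λ` is smooth at
`t₀` and `λ'(t₀) = ⟨z, T'(t₀) z⟩` for *every* unit eigenvector `z` of `T(t₀)`. With `P` the
projection onto the eigenspace at `t₀`, the function `F(t, x) = Re ⟨z, (T(t) - x + P)⁻¹ z⟩` equals
`1` along `x = λ(t)` and has `∂F/∂x = 1` at the base point, so the implicit function theorem
applies. -/
theorem hasDerivAt_eigenvalue {T : ℝ → V →L[ℂ] V} {T' : V →L[ℂ] V} {lam : ℝ → ℝ} {t₀ : ℝ}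
    (hT : ContDiffAt ℝ ∞ T t₀) (hT' : HasDerivAt T T' t₀)
    (hsymm : (T t₀ : V →ₗ[ℂ] V).IsSymmetric) (hlam : ContinuousAt lam t₀)
    (hdim : ∀ᶠ t in 𝓝 t₀,
      Module.finrank ℂ (LinearMap.ker (T t - lam t • 1 : V →L[ℂ] V).toLinearMap) =
      Module.finrank ℂ (LinearMap.ker (T t₀ - lam t₀ • 1 : V →L[ℂ] V).toLinearMap))
    {z : V} (hz : ‖z‖ = 1) (hTz : T t₀ z = lam t₀ • z) :
    ContDiffAt ℝ ∞ lam t₀ ∧ HasDerivAt lam (⟪z, T' z⟫).re t₀ := by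
  set A₀ : V →L[ℂ] V := T t₀ - lam t₀ • 1 with hA₀
  set K := LinearMap.ker A₀.toLinearMap with hK
  have hzK : z ∈ K := by simp [hK, hA₀, hTz]
  have hA₀symm : (A₀ : V →ₗ[ℂ] V).IsSymmetric := isSymmetric_sub_smul_one hsymm _
  have hU₀ : IsUnit (A₀ + K.starProjection) := isUnit_add_starProjection_ker hA₀symm
  let G : ℝ × ℝ → V →L[ℂ] V := fun p => T p.1 - p.2 • 1 + K.starProjection
  have hG0 : G (t₀, lam t₀) = A₀ + K.starProjection := rfl
  let F : ℝ × ℝ → ℝ := fun p => (⟪z, Ring.inverse (G p) z⟫).re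
  obtain ⟨U, hU⟩ := hU₀
  -- `T t₀ - λ(t₀) + P` is symmetric and fixes `z`; so is its inverse, and it fixes `z` too.
  have hUz : (U : V →L[ℂ] V) z = z := by
    rw [hU]
    have : A₀ z = 0 := hzK
    simp [this, Submodule.starProjection_eq_self_iff.2 hzK]
  have hUiz : (↑U⁻¹ : V →L[ℂ] V) z = z := by
    nth_rw 1 [← hUz]
    rw [← mul_apply_eq_comp, Units.inv_mul]; rfl
  have hUi : ∀ y, ⟪z, (↑U⁻¹ : V →L[ℂ] V) y⟫ = ⟪z, y⟫ := by
    intro y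
    have h1 : ∀ x, ⟪z, (U : V →L[ℂ] V) x⟫ = ⟪z, x⟫ := by
      intro x
      rw [hU]
      have h2 := hA₀symm z x
      have h3 : A₀ z = 0 := hzK
      simp only [ContinuousLinearMap.coe_coe, h3, inner_zero_left] at h2
      simp [← h2, ← Submodule.inner_starProjection_left_eq_right,
        Submodule.starProjection_eq_self_iff.2 hzK]
    rw [← h1, ← mul_apply_eq_comp, Units.mul_inv]; rfl
  have hGc : ContDiffAt ℝ ∞ G (t₀, lam t₀) := by
    have h1 : ContDiffAt ℝ ∞ (fun p : ℝ × ℝ => T p.1) (t₀, lam t₀) :=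
      ContDiffAt.comp (t₀, lam t₀) hT contDiffAt_fst
    exact (h1.sub (contDiffAt_snd.smul contDiffAt_const)).add contDiffAt_const
  let ev : (V →L[ℂ] V) →L[ℝ] ℝ :=
    Complex.reCLM ∘L ((innerSL ℂ z).restrictScalars ℝ) ∘L
      ((ContinuousLinearMap.apply ℂ V z).restrictScalars ℝ)
  have hev : ∀ B : V →L[ℂ] V, ev B = (⟪z, B z⟫).re := fun B => rfl
  have hinv : ContDiffAt ℝ ∞ (Ring.inverse : (V →L[ℂ] V) → _) (G (t₀, lam t₀)) := by
    rw [hG0, ← hU]; exact contDiffAt_ringInverse ℝ U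
  have hFc : ContDiffAt ℝ ∞ F (t₀, lam t₀) :=
    ev.contDiff.contDiffAt.comp (t₀, lam t₀) (hinv.comp (t₀, lam t₀) hGc)
  set a := (⟪z, T' z⟫).re with ha
  have hzz : ⟪z, z⟫ = (1 : ℂ) := by simp [inner_self_eq_norm_sq_to_K, hz]
  have hFd : HasFDerivAt F (ContinuousLinearMap.snd ℝ ℝ ℝ - a • ContinuousLinearMap.fst ℝ ℝ ℝ)
      (t₀, lam t₀) := by
    have h1 : HasFDerivAt (fun p : ℝ × ℝ => T p.1)
        ((ContinuousLinearMap.fst ℝ ℝ ℝ).smulRight T') (t₀, lam t₀) := by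
      have := HasFDerivAt.comp (t₀, lam t₀) (f := Prod.fst) hT'.hasFDerivAt hasFDerivAt_fst
      refine this.congr_fderiv ?_
      ext <;> simp
    have h2 : HasFDerivAt G ((ContinuousLinearMap.fst ℝ ℝ ℝ).smulRight T' -
        (ContinuousLinearMap.snd ℝ ℝ ℝ).smulRight 1) (t₀, lam t₀) :=
      (h1.sub ((ContinuousLinearMap.snd ℝ ℝ ℝ).smulRight (1 : V →L[ℂ] V)).hasFDerivAt).add_const _
    have h3 : HasFDerivAt (Ring.inverse : (V →L[ℂ] V) → _)
        (-ContinuousLinearMap.mulLeftRight ℝ _ (↑U⁻¹ : V →L[ℂ] V) ↑U⁻¹) (G (t₀, lam t₀)) := by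
      rw [hG0, ← hU]; exact hasFDerivAt_ringInverse U
    have h4 := ev.hasFDerivAt.comp (t₀, lam t₀) (h3.comp (t₀, lam t₀) h2)
    refine h4.congr_fderiv ?_
    ext <;> simp [hev, hUi, hUiz, hzz, ha, -inner_self_eq_norm_sq_to_K]
  have hfd := hFd.fderiv
  have hinvert : (fderiv ℝ F (t₀, lam t₀) ∘L .inr ℝ ℝ ℝ).IsInvertible := by
    rw [hfd]
    refine ⟨ContinuousLinearEquiv.refl ℝ ℝ, ?_⟩
    ext; simp
  have hF1 : ∀ᶠ t in 𝓝 t₀, F (t, lam t) = 1 := by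
    have hpair : Tendsto (fun t => G (t, lam t)) (𝓝 t₀) (𝓝 (G (t₀, lam t₀))) :=
      hGc.continuousAt.tendsto.comp (continuousAt_id.prodMk hlam).tendsto
    have hunit : ∀ᶠ t in 𝓝 t₀, IsUnit (G (t, lam t)) := by
      refine hpair.eventually ?_
      rw [hG0, ← hU]
      exact Units.isOpen.mem_nhds U.isUnit
    filter_upwards [hunit, hdim] with t ht hd
    have := inner_inverse_apply_self (A := T t - lam t • 1) ht hd hzK
    have h5 : G (t, lam t) = T t - lam t • 1 + K.starProjection := rfl
    simp only [F, h5, this, hzz, Complex.one_re]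
  have hF0 : F (t₀, lam t₀) = 1 := hF1.self_of_nhds
  have himp : ∀ᶠ t in 𝓝 t₀, hFc.implicitFunction (by simp) hinvert t = lam t := by
    have h1 := hFc.eventually_apply_eq_iff_implicitFunction (by simp) hinvert
    have h2 : Tendsto (fun t => (t, lam t)) (𝓝 t₀) (𝓝 (t₀, lam t₀)) :=
      (continuousAt_id.prodMk hlam).tendsto
    filter_upwards [h2.eventually h1, hF1] with t ht hd
    exact ht.1 (hd.trans hF0.symm)
  have hsm : ContDiffAt ℝ ∞ lam t₀ :=
    (hFc.contDiffAt_implicitFunction (by simp) hinvert).congr_of_eventuallyEq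
      (himp.mono fun t ht => ht.symm)
  refine ⟨hsm, ?_⟩
  have hd := (hsm.differentiableAt (by simp)).hasDerivAt
  have hc := hFd.comp_hasDerivAt t₀ ((hasDerivAt_id t₀).prodMk hd)
  have hz0 : HasDerivAt (fun t => F (t, lam t)) 0 t₀ :=
    (hasDerivAt_const t₀ (1 : ℝ)).congr_of_eventuallyEq hF1
  have := hc.unique hz0
  simp at this
  rw [sub_eq_zero] at this
  rwa [this] at hd

end Perturbation

/-! ### The dimension of the kernel is locally constant on a dense set -/

section Semicontinuity

variable {V : Type*} [NormedAddCommGroup V] [InnerProductSpace ℂ V] [FiniteDimensional ℂ V]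

theorem eventually_finrank_ker_le {X : Type*} [TopologicalSpace X] {A : X → V →L[ℂ] V} {x : X}
    (hA : ContinuousAt A x) (hsymm : (A x : V →ₗ[ℂ] V).IsSymmetric) :
    ∀ᶠ y in 𝓝 x, Module.finrank ℂ (LinearMap.ker (A y).toLinearMap) ≤
      Module.finrank ℂ (LinearMap.ker (A x).toLinearMap) := by
  obtain ⟨U, hU⟩ := isUnit_add_starProjection_ker hsymm
  have h1 : ∀ᶠ y in 𝓝 x, IsUnit (A y + (LinearMap.ker (A x).toLinearMap).starProjection) := by
    have h2 : ContinuousAt (fun y => A y + (LinearMap.ker (A x).toLinearMap).starProjection) x :=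
      hA.add continuousAt_const
    refine h2.tendsto.eventually ?_
    rw [← hU]
    exact Units.isOpen.mem_nhds U.isUnit
  exact h1.mono fun y hy => finrank_ker_le hy

theorem dense_setOf_eventually_finrank_ker_eq {X : Type*} [TopologicalSpace X]
    {A : X → V →L[ℂ] V} (hA : Continuous A) (hsymm : ∀ x, (A x : V →ₗ[ℂ] V).IsSymmetric) :
    Dense {x | ∀ᶠ y in 𝓝 x, Module.finrank ℂ (LinearMap.ker (A y).toLinearMap) =
      Module.finrank ℂ (LinearMap.ker (A x).toLinearMap)} := by
  rw [dense_iff_inter_open]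
  intro O hO hne
  -- a point of `O` where the kernel has the least dimension
  obtain ⟨x, hxO, hmin⟩ := WellFounded.has_min
    (InvImage.wf (fun x => Module.finrank ℂ (LinearMap.ker (A x).toLinearMap)) wellFounded_lt) O hne
  refine ⟨x, hxO, ?_⟩
  filter_upwards [hO.mem_nhds hxO, eventually_finrank_ker_le hA.continuousAt (hsymm x)]
    with y hy hle
  exact le_antisymm hle (not_lt.1 (hmin y hy))

end Semicontinuity

/-! ### Continuity of the ordered eigenvalues -/

section Weyl

variable {V : Type*} [NormedAddCommGroup V] [InnerProductSpace ℂ V]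

theorem re_inner_apply_self_eq_sum {n : ℕ} {S : V →ₗ[ℂ] V} (hS : S.IsSymmetric)
    (b : OrthonormalBasis (Fin n) ℂ V) {μ : Fin n → ℝ} (hb : ∀ i, S (b i) = (μ i : ℂ) • b i)
    (z : V) : (⟪z, S z⟫).re = ∑ i, μ i * ‖⟪b i, z⟫‖ ^ 2 := by
  rw [← b.sum_inner_mul_inner z (S z), Complex.re_sum]
  refine Finset.sum_congr rfl fun i _ => ?_
  rw [← hS, hb, inner_smul_left, Complex.conj_ofReal, mul_left_comm, Complex.re_ofReal_mul,
    ← inner_conj_symm z (b i), ← Complex.normSq_eq_conj_mul_self, Complex.normSq_eq_norm_sq]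
  norm_cast

variable [FiniteDimensional ℂ V]

/-- Monotonicity of the ordered eigenvalues in the quadratic form. The eigenvalues are listed in
decreasing order. -/
theorem eigenvalues_le_add_of_re_inner_le {n : ℕ} (hn : Module.finrank ℂ V = n)
    {S T : V →ₗ[ℂ] V} (hS : S.IsSymmetric) (hT : T.IsSymmetric) {c : ℝ}
    (h : ∀ z, (⟪z, S z⟫).re ≤ (⟪z, T z⟫).re + c * ‖z‖ ^ 2) (i : Fin n) :
    hS.eigenvalues hn i ≤ hT.eigenvalues hn i + c := by
  set bS := hS.eigenvectorBasis hn
  set bT := hT.eigenvectorBasis hn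
  -- `n - 1` linear conditions leave a nonzero `z` in the span of the eigenvectors of `S` with index
  -- at most `i` and in that of the eigenvectors of `T` with index at least `i`.
  let L : V →ₗ[ℂ] ({j : Fin n // j ≠ i} → ℂ) := LinearMap.pi fun j =>
    (innerSL ℂ (if (j : Fin n) < i then bT j else bS j)).toLinearMap
  have hlt : Module.finrank ℂ ({j : Fin n // j ≠ i} → ℂ) < Module.finrank ℂ V := by
    rw [hn, Module.finrank_fintype_fun_eq_card]
    simpa using Fintype.card_subtype_lt (p := fun j : Fin n => j ≠ i) (x := i) (by simp)
  obtain ⟨z, hz, hz0⟩ := Submodule.exists_mem_ne_zero_of_ne_bot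
    (LinearMap.ker_ne_bot_of_finrank_lt (f := L) hlt)
  have hL : ∀ j, j ≠ i → ⟪if j < i then bT j else bS j, z⟫ = 0 := fun j hj =>
    congrFun (LinearMap.mem_ker.1 hz) ⟨j, hj⟩
  have h1 : hS.eigenvalues hn i * ‖z‖ ^ 2 ≤ (⟪z, S z⟫).re := by
    rw [re_inner_apply_self_eq_sum hS bS (hS.apply_eigenvectorBasis hn),
      ← bS.sum_sq_norm_inner_right,
      Finset.mul_sum]
    refine Finset.sum_le_sum fun j _ => ?_
    rcases le_or_gt j i with hj | hj
    · exact mul_le_mul_of_nonneg_right (hS.eigenvalues_antitone hn hj) (sq_nonneg _)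
    · have := hL j hj.ne'
      rw [if_neg hj.not_gt] at this
      simp [this]
  have h2 : (⟪z, T z⟫).re ≤ hT.eigenvalues hn i * ‖z‖ ^ 2 := by
    rw [re_inner_apply_self_eq_sum hT bT (hT.apply_eigenvectorBasis hn),
      ← bT.sum_sq_norm_inner_right,
      Finset.mul_sum]
    refine Finset.sum_le_sum fun j _ => ?_
    rcases le_or_gt i j with hj | hj
    · exact mul_le_mul_of_nonneg_right (hT.eigenvalues_antitone hn hj) (sq_nonneg _)
    · have := hL j hj.ne
      rw [if_pos hj] at this
      simp [this]
  have h3 := h z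
  have h4 : 0 < ‖z‖ ^ 2 := by positivity
  nlinarith

/-- Weyl's perturbation inequality. -/
theorem abs_eigenvalues_sub_le {n : ℕ} (hn : Module.finrank ℂ V = n)
    {S T : V →L[ℂ] V} (hS : S.toLinearMap.IsSymmetric) (hT : T.toLinearMap.IsSymmetric)
    (i : Fin n) : |hS.eigenvalues hn i - hT.eigenvalues hn i| ≤ ‖S - T‖ := by
  have key : ∀ (A B : V →L[ℂ] V) (z : V),
      (⟪z, A.toLinearMap z⟫).re ≤ (⟪z, B.toLinearMap z⟫).re + ‖A - B‖ * ‖z‖ ^ 2 := by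
    intro A B z
    have h1 : (⟪z, (A - B) z⟫).re ≤ ‖z‖ * (‖A - B‖ * ‖z‖) :=
      (re_inner_le_norm (𝕜 := ℂ) z _).trans
        (mul_le_mul_of_nonneg_left ((A - B).le_opNorm z) (norm_nonneg z))
    rw [sub_apply, inner_sub_right, Complex.sub_re] at h1
    simp only [ContinuousLinearMap.coe_coe]
    linarith
  rw [abs_sub_le_iff]
  constructor
  · linarith [eigenvalues_le_add_of_re_inner_le hn hS hT (key S T) i]
  · rw [norm_sub_rev]
    linarith [eigenvalues_le_add_of_re_inner_le hn hT hS (key T S) i]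

end Weyl

/-! ### Energy levels of the Hamiltonians, and critical points as eigenvectors -/

section Critical

theorem hasFDerivAt_re_inner_apply_self {V : Type*} [NormedAddCommGroup V] [InnerProductSpace ℂ V]
    (A : V →L[ℂ] V) (hA : A.toLinearMap.IsSymmetric) (z : V) :
    HasFDerivAt (fun x => (⟪x, A x⟫).re)
      ((2 : ℝ) • (Complex.reCLM ∘L ((innerSL ℂ (A z)).restrictScalars ℝ))) z := by
  have h := Complex.reCLM.hasFDerivAt.comp z
    ((hasFDerivAt_id (𝕜 := ℝ) z).inner ℂ (A.restrictScalars ℝ).hasFDerivAt)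
  refine h.congr_fderiv ?_
  ext w
  have := hA z w
  simp only [ContinuousLinearMap.coe_coe] at this
  have h2 : (⟪w, A z⟫).re = (⟪A z, w⟫).re := by
    rw [← inner_conj_symm w (A z), Complex.conj_re]
  simp [fderivInnerCLM_apply, ← this, h2]
  ring

end Critical

section Pencil

variable {N : ℕ} {H₀ H₁ : Matrix (Fin N) (Fin N) ℂ}

/-- The operator `H_θ` on the Hilbert space, at the point `u = e^{iθ}`. -/
noncomputable def pencilCLM (H₀ H₁ : Matrix (Fin N) (Fin N) ℂ) (u : Circle) :
    EuclideanSpace ℂ (Fin N) →L[ℂ] EuclideanSpace ℂ (Fin N) :=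
  (u : ℂ).re • Matrix.toEuclideanCLM (𝕜 := ℂ) H₀ + (u : ℂ).im • Matrix.toEuclideanCLM (𝕜 := ℂ) H₁

theorem toLinearMap_pencilCLM (u : Circle) :
    (pencilCLM H₀ H₁ u).toLinearMap = Matrix.toEuclideanLin (pencil H₀ H₁ u) := by
  simp only [pencil, pencilCLM, map_add, map_smul, ← Matrix.coe_toEuclideanCLM_eq_toEuclideanLin]
  rfl

theorem toEuclideanLin_pencil_apply (u : Circle) (z : EuclideanSpace ℂ (Fin N)) :
    Matrix.toEuclideanLin (pencil H₀ H₁ u) z = pencilCLM H₀ H₁ u z := by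
  rw [← toLinearMap_pencilCLM]; rfl

theorem isSymmetric_pencilCLM (h₀ : H₀.IsHermitian) (h₁ : H₁.IsHermitian) (u : Circle) :
    (pencilCLM H₀ H₁ u).toLinearMap.IsSymmetric := by
  rw [toLinearMap_pencilCLM]
  exact Matrix.isSymmetric_toEuclideanLin_iff.2 (pencil_isHermitian h₀ h₁ u)

theorem continuous_pencilCLM : Continuous (pencilCLM H₀ H₁) := by
  unfold pencilCLM
  fun_prop

theorem energyLevel_eq_eigenvalues (h₀ : H₀.IsHermitian) (h₁ : H₁.IsHermitian) (k : Fin N)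
    (u : Circle) : energyLevel h₀ h₁ k u =
      (isSymmetric_pencilCLM h₀ h₁ u).eigenvalues finrank_euclideanSpace
        (Fin.cast (Fintype.card_fin N).symm k.rev) := by
  have h : ∀ {S T : EuclideanSpace ℂ (Fin N) →ₗ[ℂ] EuclideanSpace ℂ (Fin N)}
      (hS : S.IsSymmetric) (hT : T.IsSymmetric), S = T → ∀ i,
      hS.eigenvalues finrank_euclideanSpace i = hT.eigenvalues finrank_euclideanSpace i := by
    rintro S T hS hT rfl i; rfl
  exact h _ _ (toLinearMap_pencilCLM u).symm _

theorem continuous_energyLevel (h₀ : H₀.IsHermitian) (h₁ : H₁.IsHermitian) (k : Fin N) :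
    Continuous (energyLevel h₀ h₁ k) := by
  rw [continuous_iff_continuousAt]
  intro u
  have h1 : Tendsto (fun v => ‖pencilCLM H₀ H₁ v - pencilCLM H₀ H₁ u‖) (𝓝 u) (𝓝 0) := by
    have := ((continuous_pencilCLM (H₀ := H₀) (H₁ := H₁)).sub
      (continuous_const (y := pencilCLM H₀ H₁ u))).norm.tendsto u
    simpa using this
  rw [ContinuousAt, tendsto_iff_dist_tendsto_zero]
  refine squeeze_zero (fun _ => dist_nonneg) (fun v => ?_) h1
  rw [Real.dist_eq, energyLevel_eq_eigenvalues, energyLevel_eq_eigenvalues]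
  exact abs_eigenvalues_sub_le _ _ _ _

theorem levelMultiplicity_eq_finrank (h₀ : H₀.IsHermitian) (h₁ : H₁.IsHermitian) (k : Fin N)
    (u : Circle) : levelMultiplicity h₀ h₁ k u =
      Module.finrank ℂ (LinearMap.ker
        (pencilCLM H₀ H₁ u - energyLevel h₀ h₁ k u • 1 : _ →L[ℂ] _).toLinearMap) := by
  have h := (isSymmetric_pencilCLM h₀ h₁ u).card_filter_eigenvalues_eq finrank_euclideanSpace
    ((energyLevel h₀ h₁ k u : ℝ) : ℂ)
  have h2 : Module.End.eigenspace (pencilCLM H₀ H₁ u).toLinearMap ((energyLevel h₀ h₁ k u : ℝ) : ℂ)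
      = LinearMap.ker (pencilCLM H₀ H₁ u - energyLevel h₀ h₁ k u • 1 : _ →L[ℂ] _).toLinearMap := by
    ext x
    simp [sub_eq_zero]
  rw [← h2, ← h, levelMultiplicity]
  refine Finset.card_equiv (Fin.revPerm.trans (finCongr (Fintype.card_fin N).symm)) fun j => ?_
  simp only [Finset.mem_filter, Finset.mem_univ, true_and]
  rw [energyLevel_eq_eigenvalues h₀ h₁ j]
  exact Complex.ofReal_inj.symm

theorem energy_eq (u : Circle) :
    energy H₀ H₁ u = fun z => (⟪z, pencilCLM H₀ H₁ u z⟫).re := by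
  funext z
  rw [energy, toEuclideanLin_pencil_apply]

/-- The critical points of `φ_θ` with critical value `c` are the unit eigenvectors of `H_θ` for
the eigenvalue `c`. -/
theorem isCriticalPoint_and_energy_eq_iff (h₀ : H₀.IsHermitian) (h₁ : H₁.IsHermitian)
    {u : Circle} {z : EuclideanSpace ℂ (Fin N)} {c : ℝ} :
    IsCriticalPoint H₀ H₁ u z ∧ energy H₀ H₁ u z = c ↔
      ‖z‖ = 1 ∧ pencilCLM H₀ H₁ u z = c • z := by
  have hsymm := isSymmetric_pencilCLM h₀ h₁ u
  have hfd : ∀ w, fderiv ℝ (energy H₀ H₁ u) z w = 2 * (⟪pencilCLM H₀ H₁ u z, w⟫).re := by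
    intro w
    rw [energy_eq, (hasFDerivAt_re_inner_apply_self _ hsymm z).fderiv]
    simp
  have hzz : ‖z‖ = 1 → ⟪z, z⟫ = 1 := fun h => by rw [inner_self_eq_norm_sq_to_K, h]; simp
  constructor
  · rintro ⟨⟨hz, hcrit⟩, hc⟩
    refine ⟨hz, ?_⟩
    have hreal : ⟪z, pencilCLM H₀ H₁ u z⟫ = (c : ℂ) := by
      rw [energy_eq] at hc
      rw [← hc]
      exact (hsymm.coe_re_inner_self_apply z).symm
    -- The component `w` of `H_θ z` orthogonal to `z` is a tangent direction, along which the
    -- derivative is `2‖w‖²`.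
    set w := pencilCLM H₀ H₁ u z - (c : ℂ) • z with hw
    have hzw : ⟪z, w⟫ = 0 := by
      rw [hw, inner_sub_right, inner_smul_right, hzz hz, hreal]; simp
    have h1 := hcrit w hzw
    rw [hfd, show pencilCLM H₀ H₁ u z = w + (c : ℂ) • z by rw [hw]; abel, inner_add_left,
      inner_smul_left, hzw, mul_zero, add_zero] at h1
    have h2 : (⟪w, w⟫).re = 0 := by linarith
    have h3 : w = 0 := by
      rw [← norm_eq_zero, ← sq_eq_zero_iff, ← h2, inner_self_eq_norm_sq_to_K]
      norm_cast
    exact sub_eq_zero.1 h3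
  · rintro ⟨hz, hc⟩
    refine ⟨⟨hz, fun w hw => ?_⟩, ?_⟩
    · rw [hfd, hc, inner_smul_left_eq_smul, hw]; simp
    · rw [energy_eq]
      simp only [hc, inner_smul_right_eq_smul, hzz hz]; simp

theorem exists_unit_eigenvector (h₀ : H₀.IsHermitian) (h₁ : H₁.IsHermitian) (k : Fin N)
    (u : Circle) : ∃ z : EuclideanSpace ℂ (Fin N),
      ‖z‖ = 1 ∧ pencilCLM H₀ H₁ u z = energyLevel h₀ h₁ k u • z := by
  rw [energyLevel_eq_eigenvalues]
  set i := Fin.cast (Fintype.card_fin N).symm k.rev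
  exact ⟨(isSymmetric_pencilCLM h₀ h₁ u).eigenvectorBasis finrank_euclideanSpace i,
    OrthonormalBasis.norm_eq_one _ i,
    (isSymmetric_pencilCLM h₀ h₁ u).apply_eigenvectorBasis finrank_euclideanSpace i⟩

end Pencil

/-! ### Smooth maps on the circle in terms of the angle -/

section Circle

theorem coe_circleExp_arg {w : ℂ} (hw : w ≠ 0) : (Circle.exp w.arg : ℂ) = w / ‖w‖ := by
  have h : (‖w‖ : ℂ) ≠ 0 := by exact_mod_cast norm_ne_zero_iff.2 hw
  rw [eq_div_iff h, Circle.coe_exp, mul_comm, Complex.norm_mul_exp_arg_mul_I]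

/-- The branch of the argument that is smooth near `e^{it}` and takes the value `t` there. -/
noncomputable def branchArg (t : ℝ) (w : ℂ) : ℝ := (w / Circle.exp t).arg + t

theorem branchArg_circleExp (t : ℝ) : branchArg t (Circle.exp t) = t := by
  simp [branchArg]

theorem circleExp_branchArg (t : ℝ) {w : ℂ} (hw : w ≠ 0) :
    Circle.exp (branchArg t w) = Circle.exp w.arg := by
  ext
  rw [coe_circleExp_arg hw, branchArg, Circle.exp_add, Circle.coe_mul,
    coe_circleExp_arg (div_ne_zero hw (Circle.coe_ne_zero _)), norm_div, Circle.norm_coe, div_one]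
  field_simp [Circle.coe_ne_zero]

theorem circleExp_branchArg_coe (t : ℝ) (u : Circle) : Circle.exp (branchArg t u) = u := by
  rw [circleExp_branchArg t (Circle.coe_ne_zero u), Circle.exp_arg]

theorem contDiffAt_branchArg {t : ℝ} {w : ℂ} (hw : w / Circle.exp t ∈ Complex.slitPlane) :
    ContDiffAt ℝ ∞ (branchArg t) w := by
  have h1 : ContDiffAt ℝ ∞ (fun z : ℂ => Complex.log (z / Circle.exp t)) w :=
    ((Complex.contDiffAt_log hw).restrict_scalars ℝ).comp w
      (contDiffAt_id.div_const _)
  have h2 : branchArg t = fun z : ℂ => Complex.imCLM (Complex.log (z / Circle.exp t)) + t :=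
    funext fun z => by rw [Complex.imCLM_apply, Complex.log_im, branchArg]
  rw [h2]
  exact (Complex.imCLM.contDiff.contDiffAt.comp w h1).add contDiffAt_const

theorem contMDiff_circle_coe : ContMDiff (𝓡 1) 𝓘(ℝ, ℂ) ∞ (fun u : Circle => (u : ℂ)) := by
  have : Fact (Module.finrank ℝ ℂ = 1 + 1) := Complex.finrank_real_complex_fact
  exact contMDiff_coe_sphere (E := ℂ) (n := 1)

theorem contMDiffAt_branchArg_coe (t : ℝ) :
    ContMDiffAt (𝓡 1) 𝓘(ℝ, ℝ) ∞ (fun u : Circle => branchArg t u) (Circle.exp t) := by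
  have h : ContDiffAt ℝ ∞ (branchArg t) (Circle.exp t : ℂ) := contDiffAt_branchArg (by simp)
  exact ContMDiffAt.comp (Circle.exp t) h.contMDiffAt contMDiff_circle_coe.contMDiffAt

variable {E : Type*} [NormedAddCommGroup E] [NormedSpace ℝ E]

theorem contDiff_comp_circleExp {f : Circle → E} (hf : ContMDiff (𝓡 1) 𝓘(ℝ, E) ∞ f) :
    ContDiff ℝ ∞ (fun t : ℝ => f (Circle.exp t)) :=
  contMDiff_iff_contDiff.1 (hf.comp contMDiff_circleExp)

theorem contMDiff_of_contDiff_comp_circleExp {f : Circle → E}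
    (hf : ContDiff ℝ ∞ (fun t : ℝ => f (Circle.exp t))) : ContMDiff (𝓡 1) 𝓘(ℝ, E) ∞ f := by
  intro u
  obtain ⟨t, rfl⟩ : ∃ t, Circle.exp t = u := ⟨_, Circle.exp_arg u⟩
  have h := ContMDiffAt.comp (Circle.exp t) hf.contMDiff.contMDiffAt (contMDiffAt_branchArg_coe t)
  refine h.congr_of_eventuallyEq (Eventually.of_forall fun v => ?_)
  simp [circleExp_branchArg_coe]

/-- The extension of a smooth function on the circle to the punctured plane that is constant on
rays is smooth; the jump of `Complex.arg` is invisible after `Circle.exp`. -/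
theorem contDiffAt_comp_circleExp_arg {f : Circle → E} (hf : ContMDiff (𝓡 1) 𝓘(ℝ, E) ∞ f)
    {w : ℂ} (hw : w ≠ 0) : ContDiffAt ℝ ∞ (fun z : ℂ => f (Circle.exp z.arg)) w := by
  have hslit : w / Circle.exp w.arg ∈ Complex.slitPlane := by
    rw [coe_circleExp_arg hw, div_div_cancel₀ hw, Complex.ofReal_mem_slitPlane]
    exact norm_pos_iff.2 hw
  have h := (contDiff_comp_circleExp hf).contDiffAt.comp w (contDiffAt_branchArg hslit)
  refine h.congr_of_eventuallyEq ?_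
  filter_upwards [isOpen_ne.mem_nhds hw] with z hz
  simp [circleExp_branchArg _ hz]

theorem surjective_mfderiv_circleExp (t : ℝ) :
    Function.Surjective (mfderiv 𝓘(ℝ, ℝ) (𝓡 1) Circle.exp t) := by
  have h1 : HasMFDerivAt (𝓡 1) 𝓘(ℝ, ℝ) (fun u : Circle => branchArg t u) (Circle.exp t) _ :=
    ((contMDiffAt_branchArg_coe t).mdifferentiableAt (by simp)).hasMFDerivAt
  have h2 : MDifferentiableAt 𝓘(ℝ, ℝ) (𝓡 1) Circle.exp (branchArg t (Circle.exp t)) :=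
    (contMDiff_circleExp (m := ∞)).mdifferentiableAt (by simp)
  have h3 := HasMFDerivAt.comp (Circle.exp t) h2.hasMFDerivAt h1
  have h4 : (Circle.exp ∘ fun u : Circle => branchArg t u) = id :=
    funext fun u => circleExp_branchArg_coe t u
  rw [h4] at h3
  have h5 := hasMFDerivAt_unique h3 (hasMFDerivAt_id (I := 𝓡 1) (Circle.exp t))
  intro v
  refine ⟨mfderiv (𝓡 1) 𝓘(ℝ, ℝ) (fun u : Circle => branchArg t u) (Circle.exp t) v, ?_⟩
  have h6 := DFunLike.congr_fun h5 v
  rw [branchArg_circleExp] at h6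
  exact h6

theorem mfderiv_apply_mfderiv_circleExp {f : Circle → E} (hf : ContMDiff (𝓡 1) 𝓘(ℝ, E) ∞ f)
    (t s : ℝ) :
    @Eq E (mfderiv (𝓡 1) 𝓘(ℝ, E) f (Circle.exp t) (mfderiv 𝓘(ℝ, ℝ) (𝓡 1) Circle.exp t s))
      (s • deriv (fun t : ℝ => f (Circle.exp t)) t) := by
  have h1 : MDifferentiableAt 𝓘(ℝ, ℝ) (𝓡 1) Circle.exp t :=
    (contMDiff_circleExp (m := ∞)).mdifferentiableAt (by simp)
  have h2 := mfderiv_comp t (hf.mdifferentiableAt (by simp)) h1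
  have h3 := DFunLike.congr_fun h2 s
  refine h3.symm.trans ?_
  rw [mfderiv_eq_fderiv]
  have : (f ∘ Circle.exp) = fun t : ℝ => f (Circle.exp t) := rfl
  rw [this]
  have h4 : fderiv ℝ (fun t : ℝ => f (Circle.exp t)) t s =
    s • deriv (fun t : ℝ => f (Circle.exp t)) t := fderiv_eq_smul_deriv s
  exact h4

end Circle

/-! ### Ambient isotopies -/

section Isotopy

/-- An extension of a function on the circle to the plane: constant on rays where `c ≤ ‖w‖²`, and
cut off to vanish where `‖w‖² ≤ c / 2`. -/
noncomputable def polarExtension (c : ℝ) (f : Circle → ℝ) (w : ℂ) : ℝ :=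
  Real.smoothTransition (2 * (‖w‖ ^ 2 / c) - 1) * f (Circle.exp w.arg)

theorem polarExtension_of_le {c : ℝ} (hc : 0 < c) (f : Circle → ℝ) {w : ℂ} (hw : c ≤ ‖w‖ ^ 2) :
    polarExtension c f w = f (Circle.exp w.arg) := by
  have : 1 ≤ ‖w‖ ^ 2 / c := (one_le_div hc).2 hw
  rw [polarExtension, Real.smoothTransition.one_of_one_le (by linarith), one_mul]

theorem contDiff_polarExtension (c : ℝ) {f : Circle → ℝ}
    (hf : ContMDiff (𝓡 1) 𝓘(ℝ, ℝ) ∞ f) : ContDiff ℝ ∞ (polarExtension c f) := by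
  rw [contDiff_iff_contDiffAt]
  intro w
  by_cases hw : w = 0
  · have h0 : ∀ᶠ z : ℂ in 𝓝 w, 2 * (‖z‖ ^ 2 / c) - 1 < 0 := by
      have hcont : Continuous fun z : ℂ => 2 * (‖z‖ ^ 2 / c) - 1 := by fun_prop
      exact hcont.continuousAt.eventually_lt continuousAt_const (by simp [hw])
    refine (contDiffAt_const (c := (0 : ℝ))).congr_of_eventuallyEq ?_
    filter_upwards [h0] with z hz
    rw [polarExtension, Real.smoothTransition.zero_of_nonpos hz.le, zero_mul]
  · have h1 : ContDiff ℝ ∞ fun z : ℂ => 2 * (‖z‖ ^ 2 / c) - 1 :=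
      (contDiff_const.mul ((contDiff_norm_sq ℝ).div_const c)).sub contDiff_const
    exact (Real.smoothTransition.contDiff.comp h1).contDiffAt.mul
      (contDiffAt_comp_circleExp_arg hf hw)

/-- An ambient isotopy of a normed space from a smooth family of maps `F` and the smooth family
`G` of their inverses. -/
theorem ambientIsotopic_of_contDiff {E : Type*} [NormedAddCommGroup E] [NormedSpace ℝ E]
    {F G : ℝ × E → E} (hF : ContDiff ℝ ∞ F) (hG : ContDiff ℝ ∞ G)
    (hGF : ∀ t x, G (t, F (t, x)) = x) (hFG : ∀ t x, F (t, G (t, x)) = x)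
    (h0 : ∀ x, F (0, x) = x) {A B : Set E} (hAB : (fun x => F (1, x)) '' A = B) :
    AmbientIsotopic 𝓘(ℝ, E) A B := by
  have hslice : ∀ {K : ℝ × E → E}, ContDiff ℝ ∞ K → ∀ t,
      ContMDiff 𝓘(ℝ, E) 𝓘(ℝ, E) ∞ fun x => K (t, x) :=
    fun hK t => (hK.comp (contDiff_const.prodMk contDiff_id)).contMDiff
  refine ⟨fun t => ⟨⟨fun x => F (t, x), fun x => G (t, x), hGF t, hFG t⟩, hslice hF t, hslice hG t⟩,
    ?_, h0, hAB⟩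
  rw [← modelWithCornersSelf_prod, chartedSpaceSelf_prod]
  exact hF.contMDiff

/-- A closed curve that winds once around the axis and meets each half-plane bounded by the axis
once is unknotted: shear vertically so that its height becomes the logarithm of its radius,
rescale each horizontal plane `ℂ × {h}` by `e^{-h}` to bring it onto the unit cylinder, and shear
it down to height zero. Each of the three maps has an explicit smooth inverse on the whole space.
-/
theorem isUnknot_of_star_shaped {x y : Circle → ℝ} (hx : ContMDiff (𝓡 1) 𝓘(ℝ, ℝ) ∞ x)
    (hy : ContMDiff (𝓡 1) 𝓘(ℝ, ℝ) ∞ y) :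
    IsUnknot fun u => ((Real.exp (x u) : ℂ) * (u : ℂ), y u) := by
  obtain ⟨u₀, -, hu₀⟩ := isCompact_univ.exists_isMinOn Set.univ_nonempty hx.continuous.continuousOn
  have hmin : ∀ u, x u₀ ≤ x u := fun u => hu₀ (Set.mem_univ u)
  -- The square of the least radius: the cut-off of the first shear must not reach the curve.
  set c := Real.exp (x u₀) ^ 2 with hc
  have hc0 : 0 < c := by positivity
  have hxy : ContMDiff (𝓡 1) 𝓘(ℝ, ℝ) ∞ (fun u => x u - y u) := hx.sub hy
  set g := polarExtension c (fun u => x u - y u) with hg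
  -- The second shear acts when the curve is already on the cylinder of radius one.
  set k := polarExtension 1 x with hk
  have hgs : ContDiff ℝ ∞ g := contDiff_polarExtension c hxy
  have hks : ContDiff ℝ ∞ k := contDiff_polarExtension 1 hx
  let F : ℝ × (ℂ × ℝ) → ℂ × ℝ := fun p =>
    (Real.exp (-(p.1 * (p.2.2 + p.1 * g p.2.1))) • p.2.1, p.2.2 + p.1 * g p.2.1 -
      p.1 * k (Real.exp (-(p.1 * (p.2.2 + p.1 * g p.2.1))) • p.2.1))
  let G : ℝ × (ℂ × ℝ) → ℂ × ℝ := fun p =>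
    (Real.exp (p.1 * (p.2.2 + p.1 * k p.2.1)) • p.2.1, p.2.2 + p.1 * k p.2.1 -
      p.1 * g (Real.exp (p.1 * (p.2.2 + p.1 * k p.2.1)) • p.2.1))
  refine ambientIsotopic_of_contDiff (F := F) (G := G) ?_ ?_ ?_ ?_ ?_ ?_
  · fun_prop
  · fun_prop
  · rintro t ⟨w, h⟩
    simp only [F, G, sub_add_cancel, smul_smul, ← Real.exp_add, add_neg_cancel,
      Real.exp_zero, one_smul, add_sub_cancel_right]
  · rintro t ⟨w, h⟩
    simp only [F, G, sub_add_cancel, smul_smul, ← Real.exp_add, neg_add_cancel,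
      Real.exp_zero, one_smul, add_sub_cancel_right]
  · rintro ⟨w, h⟩
    simp [F]
  · rw [← Set.range_comp]
    congr 1
    funext u
    have hg1 : g ((Real.exp (x u) : ℂ) * (u : ℂ)) = x u - y u := by
      rw [hg, polarExtension_of_le hc0]
      · rw [Complex.arg_real_mul _ (Real.exp_pos _), Circle.exp_arg]
      · rw [norm_mul, Circle.norm_coe, mul_one, Complex.norm_real, Real.norm_eq_abs, sq_abs, hc]
        gcongr
        exact hmin u
    have hk1 : k (u : ℂ) = x u := by
      rw [hk, polarExtension_of_le one_pos _ (by rw [Circle.norm_coe, one_pow]), Circle.exp_arg]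
    have hexp : Real.exp (-x u) • ((Real.exp (x u) : ℂ) * (u : ℂ)) = u := by
      rw [Complex.real_smul, ← mul_assoc, ← Complex.ofReal_mul, ← Real.exp_add]; simp
    simp only [F, Function.comp_apply, hg1, one_mul, add_sub_cancel, hexp, hk1, sub_self]

/-- The translations `z ↦ z + t (e^{iθ} - γ(θ))` of the planes `ℂ × {θ}` carry the lift of `γ` to
the lift of the unit circle. -/
theorem isContactUnknot_contactLift {γ : Circle → ℂ} (hγ : ContMDiff (𝓡 1) 𝓘(ℝ, ℂ) ∞ γ) :
    IsContactUnknot (contactLift γ) := by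
  have hd : ContMDiff (𝓡 1) 𝓘(ℝ, ℂ) ∞ (fun u : Circle => (u : ℂ) - γ u) :=
    contMDiff_circle_coe.sub hγ
  have hsm : ∀ s : ℝ → ℝ, ContDiff ℝ ∞ s → ContMDiff (𝓘(ℝ, ℝ).prod contactModel) contactModel ∞
      (fun p : ℝ × ContactSpace =>
        ((p.2.1 + s p.1 • ((p.2.2 : ℂ) - γ p.2.2), p.2.2) : ContactSpace)) := by
    intro s hs
    refine ContMDiff.prodMk ?_ (contMDiff_snd.comp contMDiff_snd)
    refine (contMDiff_fst.comp contMDiff_snd).add ?_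
    exact (hs.contMDiff.comp contMDiff_fst).smul (hd.comp (contMDiff_snd.comp contMDiff_snd))
  have hslice : ∀ t : ℝ, ContMDiff contactModel (𝓘(ℝ, ℝ).prod contactModel) ∞
      (fun p : ContactSpace => (t, p)) := fun t => contMDiff_const.prodMk contMDiff_id
  refine ⟨fun t => ⟨⟨fun p => (p.1 + t • ((p.2 : ℂ) - γ p.2), p.2),
    fun p => (p.1 + (-t) • ((p.2 : ℂ) - γ p.2), p.2), fun p => by simp, fun p => by simp⟩,
    (hsm id contDiff_id).comp (hslice t), (hsm Neg.neg contDiff_neg).comp (hslice t)⟩,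
    hsm id contDiff_id, fun p => ?_, ?_⟩
  · change ((p.1 + (0 : ℝ) • ((p.2 : ℂ) - γ p.2), p.2) : ContactSpace) = p
    simp
  · rw [← Set.range_comp]
    congr 1
    funext u
    change ((γ u + (1 : ℝ) • ((u : ℂ) - γ u), u) : ContactSpace) = (↑u, u)
    simp

end Isotopy

/-! ### Critical value curves as one-jets of the energy level -/

section Curve

variable {N : ℕ} {H₀ H₁ : Matrix (Fin N) (Fin N) ℂ}

/-- The derivative `dH_θ/dθ = H_{θ + π/2}`. -/
noncomputable def pencilDeriv (H₀ H₁ : Matrix (Fin N) (Fin N) ℂ) (t : ℝ) :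
    EuclideanSpace ℂ (Fin N) →L[ℂ] EuclideanSpace ℂ (Fin N) :=
  (-Real.sin t) • Matrix.toEuclideanCLM (𝕜 := ℂ) H₀ + Real.cos t • Matrix.toEuclideanCLM (𝕜 := ℂ) H₁

theorem pencilCLM_circleExp (t : ℝ) : pencilCLM H₀ H₁ (Circle.exp t) =
    Real.cos t • Matrix.toEuclideanCLM (𝕜 := ℂ) H₀ +
      Real.sin t • Matrix.toEuclideanCLM (𝕜 := ℂ) H₁ := by
  rw [pencilCLM, Circle.coe_exp, Complex.exp_ofReal_mul_I_re, Complex.exp_ofReal_mul_I_im]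

theorem contDiff_pencilCLM : ContDiff ℝ ∞ fun t : ℝ => pencilCLM H₀ H₁ (Circle.exp t) := by
  simp only [pencilCLM_circleExp]
  exact (Real.contDiff_cos.smul contDiff_const).add (Real.contDiff_sin.smul contDiff_const)

theorem hasDerivAt_pencilCLM (t : ℝ) :
    HasDerivAt (fun t : ℝ => pencilCLM H₀ H₁ (Circle.exp t)) (pencilDeriv H₀ H₁ t) t := by
  simp only [pencilCLM_circleExp]
  exact ((Real.hasDerivAt_cos t).smul_const (Matrix.toEuclideanCLM (𝕜 := ℂ) H₀)).add
    ((Real.hasDerivAt_sin t).smul_const (Matrix.toEuclideanCLM (𝕜 := ℂ) H₁))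

theorem numRangeMap_eq (h₀ : H₀.IsHermitian) (h₁ : H₁.IsHermitian)
    (z : EuclideanSpace ℂ (Fin N)) : numRangeMap H₀ H₁ z =
      (⟪z, Matrix.toEuclideanCLM (𝕜 := ℂ) H₀ z⟫).re +
        (⟪z, Matrix.toEuclideanCLM (𝕜 := ℂ) H₁ z⟫).re * Complex.I := by
  have h : ∀ {H : Matrix (Fin N) (Fin N) ℂ}, H.IsHermitian →
      ((⟪z, Matrix.toEuclideanCLM (𝕜 := ℂ) H z⟫).re : ℂ) =
        ⟪z, Matrix.toEuclideanLin H z⟫ := fun hH =>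
    (Matrix.isSymmetric_toEuclideanLin_iff.2 hH).coe_re_inner_self_apply z
  rw [h h₀, h h₁, numRangeMap, map_add, map_smul, LinearMap.add_apply, LinearMap.smul_apply,
    inner_add_right, inner_smul_right, mul_comm Complex.I]

theorem re_inner_pencilCLM (h₀ : H₀.IsHermitian) (h₁ : H₁.IsHermitian) (t : ℝ)
    (z : EuclideanSpace ℂ (Fin N)) : (⟪z, pencilCLM H₀ H₁ (Circle.exp t) z⟫).re =
      Real.cos t * (numRangeMap H₀ H₁ z).re + Real.sin t * (numRangeMap H₀ H₁ z).im := by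
  rw [numRangeMap_eq h₀ h₁, pencilCLM_circleExp]
  simp [inner_smul_right_eq_smul, Complex.cos_ofReal_re, Complex.sin_ofReal_re]

theorem re_inner_pencilDeriv (h₀ : H₀.IsHermitian) (h₁ : H₁.IsHermitian) (t : ℝ)
    (z : EuclideanSpace ℂ (Fin N)) : (⟪z, pencilDeriv H₀ H₁ t z⟫).re =
      -Real.sin t * (numRangeMap H₀ H₁ z).re + Real.cos t * (numRangeMap H₀ H₁ z).im := by
  rw [numRangeMap_eq h₀ h₁, pencilDeriv]
  simp [inner_smul_right_eq_smul, Complex.cos_ofReal_re, Complex.sin_ofReal_re]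

/-- The energy level `λ_k` as a function of the angle. -/
noncomputable def levelFunction (h₀ : H₀.IsHermitian) (h₁ : H₁.IsHermitian) (k : Fin N) (t : ℝ) :
    ℝ := energyLevel h₀ h₁ k (Circle.exp t)

theorem continuous_levelFunction (h₀ : H₀.IsHermitian) (h₁ : H₁.IsHermitian) (k : Fin N) :
    Continuous (levelFunction h₀ h₁ k) :=
  (continuous_energyLevel h₀ h₁ k).comp Circle.exp.continuous

theorem re_inner_pencilCLM_of_eigenvector (h₀ : H₀.IsHermitian) (h₁ : H₁.IsHermitian)
    {t c : ℝ} {z : EuclideanSpace ℂ (Fin N)} (hz : ‖z‖ = 1)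
    (hTz : pencilCLM H₀ H₁ (Circle.exp t) z = c • z) :
    Real.cos t * (numRangeMap H₀ H₁ z).re + Real.sin t * (numRangeMap H₀ H₁ z).im = c := by
  rw [← re_inner_pencilCLM h₀ h₁, hTz, inner_smul_right_eq_smul, inner_self_eq_norm_sq_to_K, hz]
  simp

/-- Where the multiplicity is locally constant, every critical point on the level gives the same
point of the plane, with coordinates `λ_k` and `λ_k'` in the frame rotated by the angle. -/
theorem hasDerivAt_levelFunction (h₀ : H₀.IsHermitian) (h₁ : H₁.IsHermitian) (k : Fin N)
    {t : ℝ} (hm : ∀ᶠ s in 𝓝 t, levelMultiplicity h₀ h₁ k (Circle.exp s) =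
      levelMultiplicity h₀ h₁ k (Circle.exp t))
    {z : EuclideanSpace ℂ (Fin N)} (hz : ‖z‖ = 1)
    (hTz : pencilCLM H₀ H₁ (Circle.exp t) z = levelFunction h₀ h₁ k t • z) :
    ContDiffAt ℝ ∞ (levelFunction h₀ h₁ k) t ∧
      HasDerivAt (levelFunction h₀ h₁ k)
        (-Real.sin t * (numRangeMap H₀ H₁ z).re + Real.cos t * (numRangeMap H₀ H₁ z).im) t := by
  rw [← re_inner_pencilDeriv h₀ h₁]
  simp only [levelMultiplicity_eq_finrank] at hm
  exact hasDerivAt_eigenvalue contDiff_pencilCLM.contDiffAt (hasDerivAt_pencilCLM t)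
    (isSymmetric_pencilCLM h₀ h₁ _) (continuous_levelFunction h₀ h₁ k).continuousAt hm hz hTz

theorem dense_eventually_levelMultiplicity_eq (h₀ : H₀.IsHermitian) (h₁ : H₁.IsHermitian)
    (k : Fin N) : Dense {t : ℝ | ∀ᶠ s in 𝓝 t, levelMultiplicity h₀ h₁ k (Circle.exp s) =
      levelMultiplicity h₀ h₁ k (Circle.exp t)} := by
  simp only [levelMultiplicity_eq_finrank]
  refine dense_setOf_eventually_finrank_ker_eq
    (A := fun t : ℝ => pencilCLM H₀ H₁ (Circle.exp t) - levelFunction h₀ h₁ k t • 1) ?_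
    fun t => isSymmetric_sub_smul_one (isSymmetric_pencilCLM h₀ h₁ _) _
  exact (contDiff_pencilCLM.continuous).sub
    ((continuous_levelFunction h₀ h₁ k).smul continuous_const)

theorem IsCriticalValueCurve.exists_eigenvector {h₀ : H₀.IsHermitian} {h₁ : H₁.IsHermitian}
    {k : Fin N} {γ : Circle → ℂ} (hγ : IsCriticalValueCurve h₀ h₁ k γ) (t : ℝ) :
    ∃ z : EuclideanSpace ℂ (Fin N), ‖z‖ = 1 ∧
      pencilCLM H₀ H₁ (Circle.exp t) z = levelFunction h₀ h₁ k t • z ∧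
      γ (Circle.exp t) = numRangeMap H₀ H₁ z := by
  obtain ⟨z, hz, he, hg⟩ := hγ.criticalValue (Circle.exp t)
  obtain ⟨h1, h2⟩ := (isCriticalPoint_and_energy_eq_iff h₀ h₁).1 ⟨hz, he⟩
  exact ⟨z, h1, h2, hg⟩

/-- The contact condition. Both `γ` and `λ_k = cos θ Re γ + sin θ Im γ` are smooth; where the
multiplicity is locally constant, `λ_k' = -sin θ Re γ + cos θ Im γ`, and comparison with the
derivative of the formula for `λ_k` gives the claim. Such angles are dense, so the claim
holds at the crossings as well. -/
theorem IsCriticalValueCurve.legendrian {h₀ : H₀.IsHermitian} {h₁ : H₁.IsHermitian}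
    {k : Fin N} {γ : Circle → ℂ} (hγ : IsCriticalValueCurve h₀ h₁ k γ) (t : ℝ) :
    Real.cos t * (deriv (fun t : ℝ => γ (Circle.exp t)) t).re +
      Real.sin t * (deriv (fun t : ℝ => γ (Circle.exp t)) t).im = 0 := by
  set g : ℝ → ℂ := fun t => γ (Circle.exp t) with hg
  have hgs : ContDiff ℝ ∞ g := contDiff_comp_circleExp hγ.smooth
  have hgd : ∀ t, HasDerivAt g (deriv g t) t := fun t =>
    (hgs.differentiable (by simp) t).hasDerivAt
  have hgc : Continuous (deriv g) := hgs.continuous_deriv (by simp)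
  have hcont : Continuous fun t => Real.cos t * (deriv g t).re + Real.sin t * (deriv g t).im := by
    fun_prop
  have hlam : ∀ t, Real.cos t * (g t).re + Real.sin t * (g t).im = levelFunction h₀ h₁ k t := by
    intro t
    obtain ⟨z, hz, hTz, hgz⟩ := hγ.exists_eigenvector t
    have hgt : g t = numRangeMap H₀ H₁ z := hgz
    rw [hgt]
    exact re_inner_pencilCLM_of_eigenvector h₀ h₁ hz hTz
  have hzero := hcont.ext_on (dense_eventually_levelMultiplicity_eq h₀ h₁ k)
    (continuous_const (y := (0 : ℝ))) ?_
  · exact congrFun hzero t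
  intro t ht
  obtain ⟨z, hz, hTz, hgz⟩ := hγ.exists_eigenvector t
  have h1 := (hasDerivAt_levelFunction h₀ h₁ k ht hz hTz).2
  rw [← hgz] at h1
  have hre : HasDerivAt (fun t => (g t).re) (deriv g t).re t :=
    Complex.reCLM.hasFDerivAt.comp_hasDerivAt t (hgd t)
  have him : HasDerivAt (fun t => (g t).im) (deriv g t).im t :=
    Complex.imCLM.hasFDerivAt.comp_hasDerivAt t (hgd t)
  have h2 := ((Real.hasDerivAt_cos t).mul hre).add ((Real.hasDerivAt_sin t).mul him)
  have h3 := h2.unique (h1.congr_of_eventuallyEq (Eventually.of_forall hlam))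
  simp only [hg] at h3 ⊢
  linarith

theorem isLegendrianKnot_contactLift {γ : Circle → ℂ} (hγ : ContMDiff (𝓡 1) 𝓘(ℝ, ℂ) ∞ γ)
    (hleg : ∀ t : ℝ, Real.cos t * (deriv (fun t : ℝ => γ (Circle.exp t)) t).re +
      Real.sin t * (deriv (fun t : ℝ => γ (Circle.exp t)) t).im = 0) :
    IsLegendrianKnot (contactLift γ) := by
  have hmf : ∀ u, mfderiv (𝓡 1) contactModel (contactLift γ) u =
      (mfderiv (𝓡 1) 𝓘(ℝ, ℂ) γ u).prod (ContinuousLinearMap.id ℝ _) := by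
    intro u
    have := mfderiv_prodMk (hγ.mdifferentiableAt (x := u) (by simp))
      (mdifferentiableAt_id (I := 𝓡 1) (x := u))
    rw [mfderiv_id] at this
    exact this
  refine ⟨hγ.prodMk contMDiff_id, fun u v h => congrArg Prod.snd h, fun u v w h => ?_, ?_⟩
  · rw [hmf] at h
    exact congrArg Prod.snd h
  · intro u v
    obtain ⟨t, rfl⟩ : ∃ t, Circle.exp t = u := ⟨_, Circle.exp_arg u⟩
    obtain ⟨s, rfl⟩ : ∃ s : ℝ, mfderiv 𝓘(ℝ, ℝ) (𝓡 1) Circle.exp t s = v :=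
      surjective_mfderiv_circleExp t v
    have h1 := mfderiv_apply_mfderiv_circleExp hγ t s
    rw [hmf]
    change (Circle.exp t : ℂ).re * Complex.re (mfderiv (𝓡 1) 𝓘(ℝ, ℂ) γ (Circle.exp t)
        (mfderiv 𝓘(ℝ, ℝ) (𝓡 1) Circle.exp t s)) +
      (Circle.exp t : ℂ).im * Complex.im (mfderiv (𝓡 1) 𝓘(ℝ, ℂ) γ (Circle.exp t)
        (mfderiv 𝓘(ℝ, ℝ) (𝓡 1) Circle.exp t s)) = 0
    rw [h1, Circle.coe_exp, Complex.exp_ofReal_mul_I_re, Complex.exp_ofReal_mul_I_im,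
      Complex.smul_re, Complex.smul_im, smul_eq_mul, smul_eq_mul]
    linear_combination s * hleg t

theorem isUnknot_toThreeSpace_contactLift {γ : Circle → ℂ} (hγ : ContMDiff (𝓡 1) 𝓘(ℝ, ℂ) ∞ γ) :
    IsUnknot (toThreeSpace ∘ contactLift γ) :=
  isUnknot_of_star_shaped (x := fun u => (γ u).re) (y := fun u => (γ u).im)
    (Complex.reCLM.contDiff.contMDiff.comp hγ) (Complex.imCLM.contDiff.contMDiff.comp hγ)

theorem eq_of_rotated_coordinates {t a b : ℝ} {c : ℂ}
    (ha : Real.cos t * c.re + Real.sin t * c.im = a)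
    (hb : -Real.sin t * c.re + Real.cos t * c.im = b) :
    c = (Circle.exp t : ℂ) * (a + b * Complex.I) := by
  have h := Real.sin_sq_add_cos_sq t
  rw [Circle.coe_exp, Complex.exp_ofReal_mul_I]
  apply Complex.ext <;> simp [Complex.cos_ofReal_re, Complex.sin_ofReal_re,
    Complex.cos_ofReal_im, Complex.sin_ofReal_im]
  · linear_combination Real.cos t * ha - Real.sin t * hb - c.re * h
  · linear_combination Real.sin t * ha + Real.cos t * hb - c.im * h

/-- With constant multiplicity the only critical value curve is `γ(θ) = e^{iθ} (λ_k(θ) + i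
λ_k'(θ))`. -/
theorem existsUnique_isCriticalValueCurve (h₀ : H₀.IsHermitian) (h₁ : H₁.IsHermitian) (k : Fin N)
    (hm : ∀ u u' : Circle, levelMultiplicity h₀ h₁ k u = levelMultiplicity h₀ h₁ k u') :
    ∃! γ : Circle → ℂ, IsCriticalValueCurve h₀ h₁ k γ := by
  set lam := levelFunction h₀ h₁ k with hlam
  have hkey : ∀ (t : ℝ) (z : EuclideanSpace ℂ (Fin N)), ‖z‖ = 1 →
      pencilCLM H₀ H₁ (Circle.exp t) z = lam t • z → ContDiffAt ℝ ∞ lam t ∧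
      numRangeMap H₀ H₁ z = (Circle.exp t : ℂ) * (lam t + deriv lam t * Complex.I) := by
    intro t z hz hTz
    have h1 := hasDerivAt_levelFunction h₀ h₁ k (Eventually.of_forall fun s => hm _ _) hz hTz
    exact ⟨h1.1, eq_of_rotated_coordinates (re_inner_pencilCLM_of_eigenvector h₀ h₁ hz hTz)
      h1.2.deriv.symm⟩
  have hsm : ContDiff ℝ ∞ lam := by
    rw [contDiff_iff_contDiffAt]
    intro t
    obtain ⟨z, hz, hTz⟩ := exists_unit_eigenvector h₀ h₁ k (Circle.exp t)
    exact (hkey t z hz hTz).1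
  choose z hz hTz using exists_unit_eigenvector h₀ h₁ k
  refine ⟨fun u => numRangeMap H₀ H₁ (z u), ⟨?_, fun u => ⟨z u, ?_⟩⟩,
    fun γ hγ => funext fun u => ?_⟩
  · apply contMDiff_of_contDiff_comp_circleExp
    simp only [fun t : ℝ => (hkey t _ (hz _) (hTz (Circle.exp t))).2]
    have hd : ContDiff ℝ ∞ (deriv lam) := (contDiff_infty_iff_deriv.1 hsm).2
    have hof : ContDiff ℝ ∞ ((↑) : ℝ → ℂ) := Complex.ofRealCLM.contDiff
    exact (contDiff_comp_circleExp contMDiff_circle_coe).mul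
      ((hof.comp hsm).add ((hof.comp hd).mul contDiff_const))
  · have := (isCriticalPoint_and_energy_eq_iff h₀ h₁).2 ⟨hz u, hTz u⟩
    exact ⟨this.1, this.2, rfl⟩
  · obtain ⟨t, rfl⟩ : ∃ t, Circle.exp t = u := ⟨_, Circle.exp_arg u⟩
    obtain ⟨w, hw, hTw, hgw⟩ := hγ.exists_eigenvector t
    rw [hgw, (hkey t w hw hTw).2, (hkey t _ (hz _) (hTz _)).2]

end Curve

theorem mainTheorem9 (N : ℕ) (hN : 2 ≤ N) (H₀ H₁ : Matrix (Fin N) (Fin N) ℂ)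
    (h₀ : H₀.IsHermitian) (h₁ : H₁.IsHermitian) :
    ((∀ u u' : Circle,
        levelMultiplicity h₀ h₁ ⟨1, hN⟩ u = levelMultiplicity h₀ h₁ ⟨1, hN⟩ u') →
      ∃! γ : Circle → ℂ, IsCriticalValueCurve h₀ h₁ ⟨1, hN⟩ γ) ∧
    ∀ γ : Circle → ℂ, IsCriticalValueCurve h₀ h₁ ⟨1, hN⟩ γ →
      IsLegendrianKnot (contactLift γ) ∧
      IsContactUnknot (contactLift γ) ∧
      IsUnknot (toThreeSpace ∘ contactLift γ) :=
  ⟨existsUnique_isCriticalValueCurve h₀ h₁ ⟨1, hN⟩, fun _ hγ =>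
    ⟨isLegendrianKnot_contactLift hγ.smooth hγ.legendrian, isContactUnknot_contactLift hγ.smooth,
      isUnknot_toThreeSpace_contactLift hγ.smooth⟩⟩
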